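/- Let $N\ge 2$ be an integer, let $\alpha\in(0,\frac{\pi}{2}]$, and let $\phi_\infty:\mathbb R^{N-1}\to\mathbb R$ be continuous. Write $\mathbb S^{N-2}$ for the Euclidean unit sphere of $\mathbb R^{N-1}$. Call $\phi_\infty$ a viscosity solution of the eikonal equation $$|D\phi_\infty(x)|=\cot\alpha,\qquad x\in\mathbb R^{N-1},$$ if for every $\psi\in C^1(\mathbb R^{N-1})$ and every $x_0$ one has $|D\psi(x_0)|\le\cot\alpha$ whenever $\phi_\infty-\psi$ has a local maximum at $x_0$, and $|D\psi(x_0)|\ge\cot\alpha$ whenever $\phi_\infty-\psi$ has a local minimum at $x_0$. Call $\phi_\infty$ $1$-homogeneous if $\phi_\infty(tx)=t\,\phi_\infty(x)$ for all $t>0$ and all $x$. For $\gamma:\mathbb S^{N-2}\to(-\infty,+\infty]$ consider the representation $$\phi_\infty(x)=\inf_{\nu\in\mathbb S^{N-2}}\bigl(-(\cot\alpha)\,\nu\cdot x+\gamma(\nu)\bigr)\quad\text{for all }x\in\mathbb R^{N-1}.\tag{$*$}$$ (i) $\phi_\infty$ is a viscosity solution of the eikonal equation if and only if there exists a lower semicontinuous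 $\gamma:\mathbb S^{N-2}\to(-\infty,+\infty]$ such that $(*)$ holds. (ii) If $\alpha<\frac{\pi}{2}$, then for every lower semicontinuous $\gamma:\mathbb S^{N-2}\to(-\infty,+\infty]$ such that $(*)$ holds, $\phi_\infty$ is $1$-homogeneous if and only if $\gamma(\nu)\in\{0,+\infty\}$ for all $\nu\in\mathbb S^{N-2}$. (iii) For every $\alpha\in(0,\frac{\pi}{2}]$, $\phi_\infty$ is a $1$-homogeneous viscosity solution of the eikonal equation if and only if $(*)$ holds for some lower semicontinuous $\gamma:\mathbb S^{N-2}\to(-\infty,+\infty]$ with $\gamma(\nu)\in\{0,+\infty\}$ for all $\nu\in\mathbb S^{N-2}$. -/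

import Mathlib

/-- `u` is a viscosity subsolution of `|Du| = k` on `ℝⁿ`: whenever `u - ψ` has a local maximum
at `x₀`, with `ψ` a `C¹` test function, then `|Dψ(x₀)| ≤ k`. -/
def IsEikonalSubsolution {n : ℕ} (k : ℝ) (u : EuclideanSpace ℝ (Fin n) → ℝ) : Prop :=
  ∀ (ψ : EuclideanSpace ℝ (Fin n) → ℝ) (x₀ : EuclideanSpace ℝ (Fin n)),
    ContDiff ℝ 1 ψ → IsLocalMax (fun x => u x - ψ x) x₀ → ‖gradient ψ x₀‖ ≤ k

/-- `u` is a viscosity supersolution of `|Du| = k` on `ℝⁿ`: whenever `u - ψ` has a local minimum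
at `x₀`, with `ψ` a `C¹` test function, then `|Dψ(x₀)| ≥ k`. -/
def IsEikonalSupersolution {n : ℕ} (k : ℝ) (u : EuclideanSpace ℝ (Fin n) → ℝ) : Prop :=
  ∀ (ψ : EuclideanSpace ℝ (Fin n) → ℝ) (x₀ : EuclideanSpace ℝ (Fin n)),
    ContDiff ℝ 1 ψ → IsLocalMin (fun x => u x - ψ x) x₀ → k ≤ ‖gradient ψ x₀‖

/-- Viscosity solutions of the eikonal equation `|Du| = k` on `ℝⁿ`. It is applied only to
continuous functions `u`. -/
def IsEikonalViscositySolution {n : ℕ} (k : ℝ) (u : EuclideanSpace ℝ (Fin n) → ℝ) : Prop :=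
  IsEikonalSubsolution k u ∧ IsEikonalSupersolution k u

/-- Positive homogeneity of degree one: `u (t x) = t u x` for all `t > 0`. -/
def IsOneHomogeneous {n : ℕ} (u : EuclideanSpace ℝ (Fin n) → ℝ) : Prop :=
  ∀ (t : ℝ) (x : EuclideanSpace ℝ (Fin n)), 0 < t → u (t • x) = t * u x

/-- A lower semicontinuous map from the unit sphere of `ℝⁿ` to `(-∞, +∞]`. -/
def IsLscWeight {n : ℕ} (γ : Metric.sphere (0 : EuclideanSpace ℝ (Fin n)) 1 → EReal) : Prop :=
  LowerSemicontinuous γ ∧ ∀ ν, γ ν ≠ ⊥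

/-- The affine map `x ↦ -k ν · x + g`, with values in `(-∞, +∞]` when `g ∈ (-∞, +∞]`. -/
noncomputable def affineProfile {n : ℕ} (k : ℝ)
    (ν : Metric.sphere (0 : EuclideanSpace ℝ (Fin n)) 1) (g : EReal)
    (x : EuclideanSpace ℝ (Fin n)) : EReal :=
  ((-k * inner ℝ (ν : EuclideanSpace ℝ (Fin n)) x : ℝ) : EReal) + g

/-- `u(x) = inf_ν (-k ν · x + γ(ν))` for every `x`, as an identity in the extended reals; in
particular the infimum is finite. -/
def IsAffineInfimum {n : ℕ} (k : ℝ) (γ : Metric.sphere (0 : EuclideanSpace ℝ (Fin n)) 1 → EReal)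
    (u : EuclideanSpace ℝ (Fin n) → ℝ) : Prop :=
  ∀ x, (u x : EReal) = ⨅ ν, affineProfile k ν (γ ν) x

/-! With `k = cot α`, a subsolution `u` is `k`-Lipschitz, by comparison with radial barriers, and a
supersolution drops by at least `kR` from any `x` to some `y_R` on the sphere of radius `R`. Hence
`u z ≤ u x - kR + k‖z - y_R‖`. As `R → ∞`, along a subsequence of directions, these cones flatten to
an affine function of slope `k` above `u` that touches it at `x` (`exists_supergradient`). So `u` is
an infimum of such functions. Conversely, compactness of the sphere makes the infimum attained
(`exists_eq`), and the active affine function yields both viscosity inequalities. For `k > 0`,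
homogeneity along the ray through `ν` forces every finite `γ ν` to vanish (`eq_zero_or_eq_top`); for
`k = 0` the only homogeneous solution is zero. -/

open Filter Topology

section Radial

variable {n : ℕ}

/-- The gradient of a radial function `z ↦ F (‖z - x₀‖²)`. -/
theorem gradient_comp_norm_sub_sq {F : ℝ → ℝ} {F' : ℝ} (x₀ x : EuclideanSpace ℝ (Fin n))
    (hF : HasDerivAt F F' (‖x - x₀‖ ^ 2)) :
    gradient (fun z => F (‖z - x₀‖ ^ 2)) x = (2 * F') • (x - x₀) := by
  apply HasGradientAt.gradient
  rw [hasGradientAt_iff_hasFDerivAt]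
  have h1 : HasFDerivAt (fun z : EuclideanSpace ℝ (Fin n) => ‖z - x₀‖ ^ 2) _ x :=
    ((hasFDerivAt_id x).sub_const x₀).norm_sq
  have h2 := hF.comp_hasFDerivAt x h1
  refine h2.congr_fderiv ?_
  ext v
  simp
  ring

end Radial

/-! ### Subsolutions: the Lipschitz bound -/

section Lipschitz

variable {n : ℕ} {k : ℝ} {u : EuclideanSpace ℝ (Fin n) → ℝ}

/-- A continuous subsolution lies below every radial barrier whose slope exceeds `k` and which
dominates it on the boundary of a ball. -/
theorem IsEikonalSubsolution.le_add_barrier (hu : Continuous u) (hsub : IsEikonalSubsolution k u)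
    {k' R C : ℝ} (hk' : k < k') (hk0 : 0 < k') (hR : 0 < R) (hC : 0 ≤ C)
    (x₀ : EuclideanSpace ℝ (Fin n)) (m : ℕ)
    (hb : ∀ z, ‖z - x₀‖ = R → u z ≤ u x₀ + C)
    (z : EuclideanSpace ℝ (Fin n)) (hz : ‖z - x₀‖ ≤ R) :
    u z ≤ u x₀ + k' * ‖z - x₀‖ + C * (‖z - x₀‖ ^ 2 / R ^ 2) ^ (m + 1) := by
  -- The power term equals `C` on the boundary sphere, which pushes the maximum inside, and vanishes
  -- in the open ball as `m → ∞`.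
  set Φ : EuclideanSpace ℝ (Fin n) → ℝ :=
    fun z => u z - (k' * ‖z - x₀‖ + C * (‖z - x₀‖ ^ 2 / R ^ 2) ^ (m + 1)) with hΦ
  have hΦc : Continuous Φ := by fun_prop
  obtain ⟨y, hyB, hy⟩ := (isCompact_closedBall x₀ R).exists_isMaxOn
    ⟨x₀, Metric.mem_closedBall_self hR.le⟩ hΦc.continuousOn
  have hΦ0 : Φ x₀ = u x₀ := by simp [hΦ]
  have hzy : Φ z ≤ Φ y := hy (by simpa [dist_eq_norm] using hz)
  suffices h : Φ y ≤ u x₀ by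
    have := hzy.trans h
    simp only [hΦ] at this
    linarith
  by_contra! hlt
  have hyx : y ≠ x₀ := fun h => by rw [h, hΦ0] at hlt; exact lt_irrefl _ hlt
  have hc : 0 < ‖y - x₀‖ := norm_pos_iff.2 (sub_ne_zero.2 hyx)
  have hyR : ‖y - x₀‖ < R := by
    have hle : ‖y - x₀‖ ≤ R := by simpa [dist_eq_norm] using hyB
    refine lt_of_le_of_ne hle fun h => ?_
    have h1 := hb y h
    have h2 : Φ y = u y - (k' * R + C) := by
      simp only [hΦ, h]
      rw [div_self (by positivity)]
      simp
    have : 0 < k' * R := by positivity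
    linarith
  set c := ‖y - x₀‖ with hcdef
  -- By AM-GM, `k'‖w - x₀‖` lies below this quadratic, with equality at radius `c`; so the smooth
  -- function still touches at `y`, with slope at least `k' > k`.
  let F : ℝ → ℝ := fun s => k' / (2 * c) * (s + c ^ 2) + C * (s / R ^ 2) ^ (m + 1)
  have hF : HasDerivAt F
      (k' / (2 * c) + C * ((m + 1) * (c ^ 2 / R ^ 2) ^ m * (1 / R ^ 2))) (‖y - x₀‖ ^ 2) := by
    have h1 := (((hasDerivAt_id (‖y - x₀‖ ^ 2)).add_const (c ^ 2)).const_mul (k' / (2 * c))).add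
      ((((hasDerivAt_id (‖y - x₀‖ ^ 2)).div_const (R ^ 2)).pow (m + 1)).const_mul C)
    refine h1.congr_deriv ?_
    simp [← hcdef]
  have hψ : ContDiff ℝ 1 (fun z => F (‖z - x₀‖ ^ 2)) := by
    have : ContDiff ℝ 1 F := by fun_prop
    exact this.comp ((contDiff_id.sub contDiff_const).norm_sq ℝ)
  have hmax : IsLocalMax (fun z => u z - F (‖z - x₀‖ ^ 2)) y := by
    have hnhds : Metric.closedBall x₀ R ∈ 𝓝 y :=
      Filter.mem_of_superset (Metric.isOpen_ball.mem_nhds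
        (by simpa [dist_eq_norm] using hyR)) Metric.ball_subset_closedBall
    filter_upwards [hnhds] with w hw
    have h1 : Φ w ≤ Φ y := hy hw
    simp only [hΦ, ← hcdef] at h1
    have h2 : k' * ‖w - x₀‖ ≤ k' / (2 * c) * (‖w - x₀‖ ^ 2 + c ^ 2) := by
      rw [div_mul_eq_mul_div, le_div_iff₀ (by positivity)]
      nlinarith [mul_nonneg hk0.le (sq_nonneg (‖w - x₀‖ - c))]
    have h3 : k' * c = k' / (2 * c) * (c ^ 2 + c ^ 2) := by
      field_simp
      ring
    simp only [F, ← hcdef]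
    linarith
  have hle := hsub _ y hψ hmax
  rw [gradient_comp_norm_sub_sq x₀ y hF, norm_smul, ← hcdef, Real.norm_eq_abs] at hle
  have h4 : 0 ≤ C * ((m + 1) * (c ^ 2 / R ^ 2) ^ m * (1 / R ^ 2)) := by positivity
  have h5 : k' = 2 * (k' / (2 * c)) * c := by field_simp
  have h6 : 2 * (k' / (2 * c) + C * ((m + 1) * (c ^ 2 / R ^ 2) ^ m * (1 / R ^ 2))) * c ≤ k :=
    (mul_le_mul_of_nonneg_right (le_abs_self _) hc.le).trans hle
  nlinarith [mul_nonneg h4 hc.le]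

/-- Continuous subsolutions of `|Du| = k` are `k`-Lipschitz. -/
theorem IsEikonalSubsolution.le_add_mul_norm_sub (hu : Continuous u)
    (hsub : IsEikonalSubsolution k u) (hk : 0 ≤ k) (x z : EuclideanSpace ℝ (Fin n)) :
    u z ≤ u x + k * ‖z - x‖ := by
  have key : ∀ k', k < k' → u z ≤ u x + k' * ‖z - x‖ := by
    -- The extra `1` in the radius keeps `z` strictly inside the ball, so the power term tends to
    -- zero.
    intro k' hk'
    set R := ‖z - x‖ + 1 with hR
    have hR0 : 0 < R := by positivity
    obtain ⟨M, hM⟩ := ((isCompact_closedBall x R).image hu).bddAbove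
    have hMx : u x ≤ M := hM ⟨x, Metric.mem_closedBall_self hR0.le, rfl⟩
    have hbar := fun m => hsub.le_add_barrier hu hk' (hk.trans_lt hk') hR0
      (C := M - u x) (by linarith) x m
      (fun w hw => by
        have := hM ⟨w, by simp [dist_eq_norm, hw], rfl⟩
        linarith) z (by linarith)
    have hq : ‖z - x‖ ^ 2 / R ^ 2 < 1 := by
      rw [div_lt_one (by positivity)]
      exact pow_lt_pow_left₀ (by linarith) (norm_nonneg _) two_ne_zero
    have hlim : Tendsto (fun m : ℕ => u x + k' * ‖z - x‖ +
        (M - u x) * (‖z - x‖ ^ 2 / R ^ 2) ^ (m + 1)) atTop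
        (𝓝 (u x + k' * ‖z - x‖ + (M - u x) * 0)) :=
      (((tendsto_pow_atTop_nhds_zero_of_lt_one (by positivity) hq).comp
        (tendsto_add_atTop_nat 1)).const_mul _).const_add _
    have := ge_of_tendsto' hlim hbar
    simpa using this
  have hlim : Tendsto (fun k' => u x + k' * ‖z - x‖) (𝓝[>] k) (𝓝 (u x + k * ‖z - x‖)) :=
    ((continuous_const.add (continuous_id.mul continuous_const)).tendsto k).mono_left
      nhdsWithin_le_nhds
  exact ge_of_tendsto hlim (by filter_upwards [self_mem_nhdsWithin] with k' hk' using key k' hk')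

end Lipschitz

/-! ### Supersolutions: descent and supporting affine functions -/

section Supergradient

variable {n : ℕ} {k : ℝ} {u : EuclideanSpace ℝ (Fin n) → ℝ}

/-- A continuous supersolution of `|Du| = k` decreases by at least `k R` from the centre of a ball
of radius `R` to some point of its boundary. -/
theorem IsEikonalSupersolution.exists_norm_sub_eq (hn : 0 < n) (hu : Continuous u)
    (hsup : IsEikonalSupersolution k u) (hk : 0 < k) (x : EuclideanSpace ℝ (Fin n))
    {R : ℝ} (hR : 0 < R) : ∃ y, ‖y - x‖ = R ∧ u y ≤ u x - k * R := by
  by_contra! hcon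
  have : Nonempty (Fin n) := ⟨⟨0, hn⟩⟩
  obtain ⟨p, hp, hpmin⟩ := (isCompact_sphere x R).exists_isMinOn
    (NormedSpace.sphere_nonempty.2 hR.le) hu.continuousOn
  have hpR := hcon p (by simpa [dist_eq_norm] using hp)
  set ε := (u p - (u x - k * R)) / (2 * k) with hε
  have hε0 : 0 < ε := div_pos (by linarith) (by positivity)
  have hεk : k * ε < u p - (u x - k * R) := by
    have : k * ε = (u p - (u x - k * R)) / 2 := by rw [hε]; field_simp
    linarith
  -- A smoothed cone of slope strictly below `k`. Smoothing costs `kε` at the centre, half of the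
  -- gap on the sphere, so the minimum remains interior.
  let F : ℝ → ℝ := fun s => -(k * √(s + ε ^ 2))
  have hpos : ∀ z : EuclideanSpace ℝ (Fin n), 0 < ‖z - x‖ ^ 2 + ε ^ 2 := fun z => by positivity
  have hψ : ContDiff ℝ 1 (fun z => F (‖z - x‖ ^ 2)) :=
    (contDiff_const.mul (ContDiff.sqrt
      (((contDiff_id.sub contDiff_const).norm_sq ℝ).add contDiff_const)
      fun z => (hpos z).ne')).neg
  obtain ⟨y, hyB, hy⟩ := (isCompact_closedBall x R).exists_isMinOn
    ⟨x, Metric.mem_closedBall_self hR.le⟩ (hu.sub hψ.continuous).continuousOn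
  have hyx : u y + k * √(‖y - x‖ ^ 2 + ε ^ 2) ≤ u x + k * ε := by
    have h : u y - F (‖y - x‖ ^ 2) ≤ u x - F (‖x - x‖ ^ 2) :=
      hy (Metric.mem_closedBall_self hR.le)
    simpa [F, Real.sqrt_sq hε0.le] using h
  have hyR : ‖y - x‖ < R := by
    have hle : ‖y - x‖ ≤ R := by simpa [dist_eq_norm] using hyB
    refine lt_of_le_of_ne hle fun h => ?_
    have h1 : u p ≤ u y := hpmin (by simpa [dist_eq_norm] using h)
    have h2 : R ≤ √(‖y - x‖ ^ 2 + ε ^ 2) := by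
      rw [h]
      exact Real.le_sqrt_of_sq_le (by nlinarith)
    nlinarith
  have hmin : IsLocalMin (fun z => u z - F (‖z - x‖ ^ 2)) y := by
    have hnhds : Metric.closedBall x R ∈ 𝓝 y :=
      Filter.mem_of_superset (Metric.isOpen_ball.mem_nhds
        (by simpa [dist_eq_norm] using hyR)) Metric.ball_subset_closedBall
    filter_upwards [hnhds] with w hw using hy hw
  have hge := hsup _ y hψ hmin
  have hF : HasDerivAt F (-(k * (1 / (2 * √(‖y - x‖ ^ 2 + ε ^ 2))))) (‖y - x‖ ^ 2) :=
    ((((hasDerivAt_id (‖y - x‖ ^ 2)).add_const (ε ^ 2)).sqrt (hpos y).ne').const_mul k).neg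
  rw [gradient_comp_norm_sub_sq x y hF, norm_smul, Real.norm_eq_abs] at hge
  set r := √(‖y - x‖ ^ 2 + ε ^ 2) with hr
  have hr0 : 0 < r := Real.sqrt_pos.2 (hpos y)
  have hlt : ‖y - x‖ < r := Real.lt_sqrt_of_sq_lt (by nlinarith)
  have hcoef : 2 * -(k * (1 / (2 * r))) = -(k / r) := by field_simp
  rw [hcoef, abs_neg, abs_of_pos (by positivity), div_mul_eq_mul_div, le_div_iff₀ hr0] at hge
  nlinarith

/-- An entire continuous viscosity solution of `|Du| = k` lies, at each point, below an affine
function of slope `k` which touches it there. -/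
theorem IsEikonalViscositySolution.exists_supergradient (hn : 0 < n) (hu : Continuous u)
    (hsol : IsEikonalViscositySolution k u) (hk : 0 ≤ k) (x : EuclideanSpace ℝ (Fin n)) :
    ∃ ν : Metric.sphere (0 : EuclideanSpace ℝ (Fin n)) 1,
      ∀ z, u z ≤ u x - k * inner ℝ (ν : EuclideanSpace ℝ (Fin n)) (z - x) := by
  have : Nonempty (Fin n) := ⟨⟨0, hn⟩⟩
  have hlip := hsol.1.le_add_mul_norm_sub hu hk
  rcases hk.eq_or_lt with rfl | hk0
  · obtain ⟨ν, hν⟩ := NormedSpace.sphere_nonempty (x := (0 : EuclideanSpace ℝ (Fin n)))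
      (r := 1).2 zero_le_one
    exact ⟨⟨ν, hν⟩, fun z => by simpa using hlip x z⟩
  have hm : ∀ m : ℕ, (0 : ℝ) < m + 1 := fun m => by positivity
  choose y hyn hyu using fun m : ℕ => hsol.2.exists_norm_sub_eq hn hu hk0 x (hm m)
  let ν : ℕ → Metric.sphere (0 : EuclideanSpace ℝ (Fin n)) 1 := fun m =>
    ⟨((m : ℝ) + 1)⁻¹ • (y m - x), by
      rw [mem_sphere_zero_iff_norm, norm_smul, hyn, norm_inv, Real.norm_of_nonneg (hm m).le,
        inv_mul_cancel₀ (hm m).ne']⟩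
  -- The Lipschitz bound from `y m`, with `‖z - y m‖` linearized by AM-GM at radius `m + 1`; the
  -- error is `O(1 / m)`.
  have hbound : ∀ z m, u z ≤ u x - k * inner ℝ (ν m : EuclideanSpace ℝ (Fin n)) (z - x)
      + k * (‖z - x‖ ^ 2 / 2 * (1 / ((m : ℝ) + 1))) := by
    intro z m
    have h1 := hlip (y m) z
    have h2 := hyu m
    have h3 : ‖z - y m‖ ^ 2 = ‖z - x‖ ^ 2 - 2 * inner ℝ (y m - x) (z - x)
        + ((m : ℝ) + 1) ^ 2 := by
      rw [← hyn m, ← sub_sub_sub_cancel_right z (y m) x, norm_sub_sq_real,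
        real_inner_comm (y m - x)]
    have h4 : inner ℝ (ν m : EuclideanSpace ℝ (Fin n)) (z - x)
        = ((m : ℝ) + 1)⁻¹ * inner ℝ (y m - x) (z - x) := by
      simp [ν, inner_smul_left]
    have h5 : ‖z - y m‖ ≤ ((m : ℝ) + 1) - inner ℝ (ν m : EuclideanSpace ℝ (Fin n)) (z - x)
        + ‖z - x‖ ^ 2 / 2 * (1 / ((m : ℝ) + 1)) := by
      have h6 : ((m : ℝ) + 1) - inner ℝ (ν m : EuclideanSpace ℝ (Fin n)) (z - x)
          + ‖z - x‖ ^ 2 / 2 * (1 / ((m : ℝ) + 1))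
          = (‖z - y m‖ ^ 2 + ((m : ℝ) + 1) ^ 2) / (2 * ((m : ℝ) + 1)) := by
        rw [h4, h3]
        have := (hm m).ne'
        field_simp
        ring
      rw [h6, le_div_iff₀ (by linarith [hm m])]
      nlinarith [sq_nonneg (‖z - y m‖ - ((m : ℝ) + 1))]
    nlinarith [mul_le_mul_of_nonneg_left h5 hk]
  have : CompactSpace (Metric.sphere (0 : EuclideanSpace ℝ (Fin n)) 1) :=
    isCompact_iff_compactSpace.1 (isCompact_sphere _ _)
  obtain ⟨a, -, σ, hσ, hlim⟩ := isCompact_univ.tendsto_subseq (x := ν) fun _ => Set.mem_univ _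
  refine ⟨a, fun z => ?_⟩
  have hin : Tendsto (fun m => inner ℝ (ν (σ m) : EuclideanSpace ℝ (Fin n)) (z - x)) atTop
      (𝓝 (inner ℝ (a : EuclideanSpace ℝ (Fin n)) (z - x))) :=
    ((continuous_subtype_val.inner continuous_const).tendsto a).comp hlim
  have h0 : Tendsto (fun m => 1 / (((σ m : ℕ) : ℝ) + 1)) atTop (𝓝 0) :=
    tendsto_one_div_add_atTop_nhds_zero_nat.comp hσ.tendsto_atTop
  have hall := ((hin.const_mul k).const_sub (u x)).add
    ((h0.const_mul (‖z - x‖ ^ 2 / 2)).const_mul k)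
  have := ge_of_tendsto' hall fun m => hbound z (σ m)
  simpa using this

end Supergradient

/-! ### Infima of affine functions and homogeneity -/

section AffineInfimum

variable {n : ℕ} {k : ℝ} {u : EuclideanSpace ℝ (Fin n) → ℝ}
  {γ : Metric.sphere (0 : EuclideanSpace ℝ (Fin n)) 1 → EReal}

/-- Entire viscosity solutions are infima of affine functions of slope `k`, with the weight given
by the (concave) conjugate. -/
theorem IsEikonalViscositySolution.exists_isAffineInfimum (hn : 0 < n) (hu : Continuous u)
    (hsol : IsEikonalViscositySolution k u) (hk : 0 ≤ k) :
    ∃ γ : Metric.sphere (0 : EuclideanSpace ℝ (Fin n)) 1 → EReal,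
      IsLscWeight γ ∧ IsAffineInfimum k γ u := by
  -- The least weight keeping every affine profile above `u`; a supremum of continuous functions of
  -- `ν`, hence lower semicontinuous.
  refine ⟨fun ν => ⨆ z, ((u z + k * inner ℝ (ν : EuclideanSpace ℝ (Fin n)) z : ℝ) : EReal),
    ⟨lowerSemicontinuous_iSup fun z => ?_, fun ν => ?_⟩, fun x => le_antisymm ?_ ?_⟩
  · refine Continuous.lowerSemicontinuous (continuous_coe_real_ereal.comp ?_)
    exact continuous_const.add (continuous_const.mul
      (continuous_subtype_val.inner continuous_const))
  · exact ne_bot_of_le_ne_bot (EReal.coe_ne_bot _)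
      (le_iSup (fun z => ((u z + k * inner ℝ (ν : EuclideanSpace ℝ (Fin n)) z : ℝ) : EReal)) 0)
  · refine le_iInf fun ν => ?_
    have h := le_iSup
      (fun z => ((u z + k * inner ℝ (ν : EuclideanSpace ℝ (Fin n)) z : ℝ) : EReal)) x
    refine le_trans (le_of_eq ?_) (add_le_add_right h _)
    rw [← EReal.coe_add]
    congr 1
    ring
  · obtain ⟨ν, hν⟩ := hsol.exists_supergradient hn hu hk x
    refine (iInf_le _ ν).trans ?_
    have h : (⨆ z, ((u z + k * inner ℝ (ν : EuclideanSpace ℝ (Fin n)) z : ℝ) : EReal)) ≤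
        ((u x + k * inner ℝ (ν : EuclideanSpace ℝ (Fin n)) x : ℝ) : EReal) := by
      refine iSup_le fun z => EReal.coe_le_coe_iff.2 ?_
      have := hν z
      rw [inner_sub_right] at this
      linarith
    refine (add_le_add_right h _).trans (le_of_eq ?_)
    rw [← EReal.coe_add]
    congr 1
    ring

theorem IsAffineInfimum.le_of_eq_coe (h : IsAffineInfimum k γ u)
    {ν : Metric.sphere (0 : EuclideanSpace ℝ (Fin n)) 1} {g : ℝ} (hg : γ ν = g)
    (x : EuclideanSpace ℝ (Fin n)) :
    u x ≤ -k * inner ℝ (ν : EuclideanSpace ℝ (Fin n)) x + g := by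
  have h1 : (u x : EReal) ≤ affineProfile k ν (γ ν) x := (h x).trans_le (iInf_le _ ν)
  rw [affineProfile, hg, ← EReal.coe_add] at h1
  exact EReal.coe_le_coe_iff.1 h1

/-- The infimum of affine profiles with a lower semicontinuous weight is attained. -/
theorem IsAffineInfimum.exists_eq (hn : 0 < n) (hγ : IsLscWeight γ) (h : IsAffineInfimum k γ u)
    (x : EuclideanSpace ℝ (Fin n)) :
    ∃ (ν : Metric.sphere (0 : EuclideanSpace ℝ (Fin n)) 1) (g : ℝ), γ ν = g ∧
      u x = -k * inner ℝ (ν : EuclideanSpace ℝ (Fin n)) x + g := by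
  have : Nonempty (Fin n) := ⟨⟨0, hn⟩⟩
  have : CompactSpace (Metric.sphere (0 : EuclideanSpace ℝ (Fin n)) 1) :=
    isCompact_iff_compactSpace.1 (isCompact_sphere _ _)
  have : Nonempty (Metric.sphere (0 : EuclideanSpace ℝ (Fin n)) 1) :=
    (NormedSpace.sphere_nonempty.2 zero_le_one).to_subtype
  have hlsc : LowerSemicontinuous fun ν => affineProfile k ν (γ ν) x := by
    refine LowerSemicontinuous.add' (Continuous.lowerSemicontinuous
      (continuous_coe_real_ereal.comp (continuous_const.mul
        (continuous_subtype_val.inner continuous_const)))) hγ.1 fun ν => ?_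
    exact EReal.continuousAt_add (Or.inl (EReal.coe_ne_top _)) (Or.inl (EReal.coe_ne_bot _))
  obtain ⟨ν, -, hν⟩ := (hlsc.lowerSemicontinuousOn Set.univ).exists_isMinOn
    Set.univ_nonempty isCompact_univ
  have heq : (u x : EReal) = affineProfile k ν (γ ν) x :=
    (h x).trans (le_antisymm (iInf_le _ ν) (le_iInf fun μ => hν (Set.mem_univ μ)))
  have htop : γ ν ≠ ⊤ := fun ht => by
    rw [affineProfile, ht, EReal.coe_add_top] at heq
    exact EReal.coe_ne_top _ heq
  refine ⟨ν, (γ ν).toReal, (EReal.coe_toReal htop (hγ.2 ν)).symm, ?_⟩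
  rw [affineProfile, ← EReal.coe_toReal htop (hγ.2 ν), ← EReal.coe_add] at heq
  exact EReal.coe_eq_coe_iff.1 heq

theorem IsAffineInfimum.le_add_mul_norm_sub (hn : 0 < n) (hγ : IsLscWeight γ)
    (h : IsAffineInfimum k γ u) (hk : 0 ≤ k) (x z : EuclideanSpace ℝ (Fin n)) :
    u z ≤ u x + k * ‖z - x‖ := by
  obtain ⟨ν, g, hg, hx⟩ := h.exists_eq hn hγ x
  have hz := h.le_of_eq_coe hg z
  have h1 := neg_le_of_abs_le (abs_real_inner_le_norm (ν : EuclideanSpace ℝ (Fin n)) (z - x))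
  rw [norm_eq_of_mem_sphere ν, one_mul, inner_sub_right] at h1
  nlinarith [mul_le_mul_of_nonneg_left h1 hk]

/-- At a local maximum, the Lipschitz bound on `u` limits the decrease of `ψ` in every direction;
using `v` and `-v` bounds its derivative. -/
theorem IsAffineInfimum.isEikonalSubsolution (hn : 0 < n) (hγ : IsLscWeight γ)
    (h : IsAffineInfimum k γ u) (hk : 0 ≤ k) : IsEikonalSubsolution k u := by
  intro ψ x₀ hψ hmax
  have hd : HasFDerivAt ψ (fderiv ℝ ψ x₀) x₀ :=
    (hψ.differentiable one_ne_zero x₀).hasFDerivAt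
  rw [gradient, LinearIsometryEquiv.norm_map]
  have hle : ∀ᶠ x in 𝓝 x₀, ψ x₀ - ψ x ≤ k * ‖x - x₀‖ := by
    filter_upwards [hmax] with x hx
    have := h.le_add_mul_norm_sub hn hγ hk x x₀
    rw [norm_sub_rev] at this
    linarith
  refine ContinuousLinearMap.opNorm_le_bound _ hk fun v => ?_
  have hdir : ∀ w, -(fderiv ℝ ψ x₀ w) ≤ k * ‖w‖ := by
    intro w
    have hline : HasDerivAt (fun t : ℝ => ψ (x₀ + t • w)) (fderiv ℝ ψ x₀ w) 0 := by
      simpa [HasLineDerivAt] using hd.hasLineDerivAt w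
    have hslope : Tendsto (slope (fun t : ℝ => ψ (x₀ + t • w)) 0) (𝓝[>] 0)
        (𝓝 (fderiv ℝ ψ x₀ w)) := (hasDerivAt_iff_tendsto_slope.1 hline).mono_left
      (nhdsWithin_mono (0 : ℝ) fun t (ht : 0 < t) => ht.ne')
    have hcont : Tendsto (fun t : ℝ => x₀ + t • w) (𝓝[>] 0) (𝓝 x₀) := by
      have : Continuous fun t : ℝ => x₀ + t • w := by fun_prop
      simpa using (this.tendsto 0).mono_left nhdsWithin_le_nhds
    have := ge_of_tendsto hslope (b := -(k * ‖w‖)) (by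
      filter_upwards [hcont.eventually hle, self_mem_nhdsWithin] with t ht ht0
      have ht0' : (0 : ℝ) < t := ht0
      rw [slope_def_field, sub_zero, zero_smul, add_zero, le_div_iff₀ ht0']
      rw [add_sub_cancel_left, norm_smul, Real.norm_of_nonneg ht0'.le] at ht
      linarith)
    linarith
  rw [Real.norm_eq_abs, abs_le]
  have h1 := hdir v
  have h2 := hdir (-v)
  rw [map_neg, norm_neg] at h2
  constructor <;> linarith

/-- The affine function active at `x₀` touches `u` from above and `ψ`, up to a constant, touches
from below, so their gradients agree and have norm `|k|`. -/
theorem IsAffineInfimum.isEikonalSupersolution (hn : 0 < n) (hγ : IsLscWeight γ)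
    (h : IsAffineInfimum k γ u) : IsEikonalSupersolution k u := by
  intro ψ x₀ hψ hmin
  obtain ⟨ν, g, hg, hx⟩ := h.exists_eq hn hγ x₀
  have hd : HasFDerivAt ψ (fderiv ℝ ψ x₀) x₀ :=
    (hψ.differentiable one_ne_zero x₀).hasFDerivAt
  have hmax : IsLocalMax
      (fun x => ψ x + (k • innerSL ℝ (ν : EuclideanSpace ℝ (Fin n))) x) x₀ := by
    filter_upwards [hmin] with x hx'
    have := h.le_of_eq_coe hg x
    simp only [smul_apply, innerSL_apply_apply, smul_eq_mul]
    linarith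
  have hzero := hmax.hasFDerivAt_eq_zero
    (hd.add (k • innerSL ℝ (ν : EuclideanSpace ℝ (Fin n))).hasFDerivAt)
  rw [gradient, LinearIsometryEquiv.norm_map, eq_neg_of_add_eq_zero_left hzero, norm_neg,
    norm_smul, innerSL_apply_norm, norm_eq_of_mem_sphere ν, mul_one]
  exact le_abs_self k

theorem IsAffineInfimum.isEikonalViscositySolution (hn : 0 < n) (hγ : IsLscWeight γ)
    (h : IsAffineInfimum k γ u) (hk : 0 ≤ k) : IsEikonalViscositySolution k u :=
  ⟨h.isEikonalSubsolution hn hγ hk, h.isEikonalSupersolution hn hγ⟩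

theorem IsAffineInfimum.isOneHomogeneous (hn : 0 < n) (hγ : IsLscWeight γ)
    (h : IsAffineInfimum k γ u) (hγ0 : ∀ ν, γ ν = 0 ∨ γ ν = ⊤) : IsOneHomogeneous u := by
  have key : ∀ (t : ℝ) (x : EuclideanSpace ℝ (Fin n)), u (t • x) ≤ t * u x := by
    intro t x
    obtain ⟨ν, g, hg, hx⟩ := h.exists_eq hn hγ x
    have hg0 : g = 0 := by
      rcases hγ0 ν with h0 | h0
      · rw [h0] at hg
        exact_mod_cast hg.symm
      · rw [h0] at hg
        exact absurd hg.symm (EReal.coe_ne_top g)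
    have := h.le_of_eq_coe hg (t • x)
    rw [inner_smul_right, hg0] at this
    rw [hx, hg0]
    linarith
  intro t x ht
  refine le_antisymm (key t x) ?_
  -- The reverse inequality is the same bound for the inverse scaling.
  have := key t⁻¹ (t • x)
  rw [smul_smul, inv_mul_cancel₀ ht.ne', one_smul, inv_mul_eq_div, le_div_iff₀ ht] at this
  linarith

theorem IsOneHomogeneous.map_zero (h : IsOneHomogeneous u) : u 0 = 0 := by
  have := h 2 0 two_pos
  rw [smul_zero] at this
  linarith

/-- If `γ ν` is finite, dividing `u (t • ν) ≤ -k t + γ ν` by `t → ∞` gives `u ν ≤ -k`. A direction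
`μ` active at `ν` has weight `g ≥ 0` because `u 0 = 0`, so `-k μ·ν + g ≤ -k` forces `μ = ν` and `g =
0`. -/
theorem IsAffineInfimum.eq_zero_or_eq_top (hn : 0 < n) (hγ : IsLscWeight γ)
    (h : IsAffineInfimum k γ u) (hk : 0 < k) (hu : IsOneHomogeneous u)
    (ν : Metric.sphere (0 : EuclideanSpace ℝ (Fin n)) 1) : γ ν = 0 ∨ γ ν = ⊤ := by
  refine or_iff_not_imp_right.2 fun htop => ?_
  have hν : ‖(ν : EuclideanSpace ℝ (Fin n))‖ = 1 := norm_eq_of_mem_sphere ν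
  have hle : u ν ≤ -k := by
    have hbound : ∀ m : ℕ, u ν ≤ -k + (γ ν).toReal * (1 / ((m : ℝ) + 1)) := by
      intro m
      have hm : (0 : ℝ) < m + 1 := by positivity
      have h1 := h.le_of_eq_coe (EReal.coe_toReal htop (hγ.2 ν)).symm
        (((m : ℝ) + 1) • (ν : EuclideanSpace ℝ (Fin n)))
      rw [hu _ _ hm, inner_smul_right, real_inner_self_eq_norm_sq, hν] at h1
      have h2 : -k + (γ ν).toReal * (1 / ((m : ℝ) + 1))
          = (-k * ((m + 1) * 1 ^ 2) + (γ ν).toReal) / ((m : ℝ) + 1) := by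
        field_simp
      rw [h2, le_div_iff₀ hm]
      linarith
    simpa using ge_of_tendsto'
      ((tendsto_one_div_add_atTop_nhds_zero_nat.const_mul (γ ν).toReal).const_add (-k)) hbound
  obtain ⟨μ, g, hg, hμ⟩ := h.exists_eq hn hγ ν
  have hg0 : 0 ≤ g := by
    have := h.le_of_eq_coe hg 0
    rw [hu.map_zero, inner_zero_right] at this
    linarith
  have hμ1 : ‖(μ : EuclideanSpace ℝ (Fin n))‖ = 1 := norm_eq_of_mem_sphere μ
  have hin := real_inner_le_norm (μ : EuclideanSpace ℝ (Fin n)) ν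
  rw [hν, hμ1, one_mul] at hin
  have hin1 : inner ℝ (μ : EuclideanSpace ℝ (Fin n)) (ν : EuclideanSpace ℝ (Fin n)) = 1 := by
    refine le_antisymm hin ?_
    by_contra! hlt
    nlinarith
  have hμν : μ = ν := Subtype.ext ((inner_eq_one_iff_of_norm_eq_one hμ1 hν).1 hin1)
  rw [hin1] at hμ
  have : g = 0 := by linarith
  rw [← hμν, hg, this, EReal.coe_zero]

end AffineInfimum

theorem IsEikonalViscositySolution.eq_zero_of_isOneHomogeneous {n : ℕ}
    {u : EuclideanSpace ℝ (Fin n) → ℝ} (hu : Continuous u)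
    (hsol : IsEikonalViscositySolution 0 u) (hhom : IsOneHomogeneous u)
    (x : EuclideanSpace ℝ (Fin n)) : u x = 0 := by
  have h1 := hsol.1.le_add_mul_norm_sub hu le_rfl x 0
  have h2 := hsol.1.le_add_mul_norm_sub hu le_rfl 0 x
  rw [zero_mul, hhom.map_zero] at h1 h2
  linarith

theorem isLscWeight_zero {n : ℕ} :
    IsLscWeight fun _ : Metric.sphere (0 : EuclideanSpace ℝ (Fin n)) 1 => (0 : EReal) :=
  ⟨lowerSemicontinuous_const, fun _ => EReal.zero_ne_bot⟩

theorem proposition2p1 (N : ℕ) (hN : 2 ≤ N) (α : ℝ) (hα₀ : 0 < α) (hα₁ : α ≤ Real.pi / 2)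
    (φ : EuclideanSpace ℝ (Fin (N - 1)) → ℝ) (hφ : Continuous φ) :
    (IsEikonalViscositySolution (Real.cot α) φ ↔
      ∃ γ : Metric.sphere (0 : EuclideanSpace ℝ (Fin (N - 1))) 1 → EReal,
        IsLscWeight γ ∧ IsAffineInfimum (Real.cot α) γ φ) ∧
    (α < Real.pi / 2 →
      ∀ γ : Metric.sphere (0 : EuclideanSpace ℝ (Fin (N - 1))) 1 → EReal,
        IsLscWeight γ → IsAffineInfimum (Real.cot α) γ φ →
          (IsOneHomogeneous φ ↔ ∀ ν, γ ν = 0 ∨ γ ν = ⊤)) ∧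
    (IsEikonalViscositySolution (Real.cot α) φ ∧ IsOneHomogeneous φ ↔
      ∃ γ : Metric.sphere (0 : EuclideanSpace ℝ (Fin (N - 1))) 1 → EReal,
        IsLscWeight γ ∧ IsAffineInfimum (Real.cot α) γ φ ∧ ∀ ν, γ ν = 0 ∨ γ ν = ⊤) := by
  have hn : 0 < N - 1 := by omega
  have hk : 0 ≤ Real.cot α := by
    rw [Real.cot_eq_cos_div_sin]
    exact div_nonneg (Real.cos_nonneg_of_mem_Icc ⟨by linarith, hα₁⟩)
      (Real.sin_nonneg_of_nonneg_of_le_pi hα₀.le (by linarith))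
  have hkpos : α < Real.pi / 2 → 0 < Real.cot α := fun h => by
    rw [Real.cot_eq_cos_div_sin]
    exact div_pos (Real.cos_pos_of_mem_Ioo ⟨by linarith, h⟩)
      (Real.sin_pos_of_pos_of_lt_pi hα₀ (by linarith))
  refine ⟨⟨fun h => h.exists_isAffineInfimum hn hφ hk,
      fun ⟨γ, hγ, h⟩ => h.isEikonalViscositySolution hn hγ hk⟩,
    fun hα γ hγ h => ⟨h.eq_zero_or_eq_top hn hγ (hkpos hα), h.isOneHomogeneous hn hγ⟩,
    fun ⟨hsol, hhom⟩ => ?_, fun ⟨γ, hγ, h, hγ0⟩ =>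
      ⟨h.isEikonalViscositySolution hn hγ hk, h.isOneHomogeneous hn hγ hγ0⟩⟩
  -- For `k = 0` only the infimum of `γ` matters, so a representing weight may take other values;
  -- the zero weight is chosen instead.
  rcases hk.eq_or_lt with hk0 | hk0
  · rw [← hk0] at hsol ⊢
    have : Nonempty (Fin (N - 1)) := ⟨⟨0, hn⟩⟩
    have : Nonempty (Metric.sphere (0 : EuclideanSpace ℝ (Fin (N - 1))) 1) :=
      (NormedSpace.sphere_nonempty.2 zero_le_one).to_subtype
    refine ⟨fun _ => 0, isLscWeight_zero, fun x => ?_, fun _ => Or.inl rfl⟩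
    simp [affineProfile, hsol.eq_zero_of_isOneHomogeneous hφ hhom x]
  · obtain ⟨γ, hγ, h⟩ := hsol.exists_isAffineInfimum hn hφ hk
    exact ⟨γ, hγ, h, h.eq_zero_or_eq_top hn hγ hk0 hhom⟩
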